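/- **Conventions.** A *pospace* is a topological space with a partial order (not assumed closed); a *dimap* is a continuous monotone map. Let $I=[0,1]$, and for a space $S$ let $(S,\Delta)$ be $S$ with equality as partial order. Products of pospaces carry the product topology and the componentwise order. Fix a pospace $(C,\leq)$. A *$(C,\leq)$-pospace* is a pospace $X$ with a dimap $\xi:C\to X$; a *$(C,\leq)$-dimap* $(X,\xi)\to(Y,\theta)$ is a dimap $f:X\to Y$ with $f\circ\xi=\theta$. These form the category $(C,\leq)\text{-}\mathbf{poTop}$, with initial object $(C,\leq,\mathrm{id}_C)$. *Dihomotopy.* Two $(C,\leq)$-dimaps $f,g:(X,\xi)\to(Y,\theta)$ are *dihomotopic relative to $(C,\leq)$* if there is a dimap $H:X\times(I,\Delta)\to Y$ with $H(x,0)=f(x)$, $H(x,1)=g(x)$ and $H(\xi(c),t)=\theta(c)$ for all $x\in X$, $c\in C$, $t\in I$. A $(C,\leq)$-dimap $f$ is a *dihomotopy equivalence relative to $(C,\leq)$* if there is a $(C,\leq)$-dimap $g$ in the opposite direction such that $f\circ g$ and $g\circ f$ are dihomotopic relative to $(C,\leq)$ to the identities. *Dicofibrations.* The *cylinder* $X\,\square_C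 I$ on $(X,\xi)$ is the quotient space of $X\times I$ in which, for each $c \in C$, the points $(\xi(c),t)$, $t\in I$, are identified, with the order $[x,s]\leq[x',s']$ iff ($x\leq x'$ and $s=s'$) or $x\leq\xi(c)\leq x'$ for some $c\in C$, and with the structure dimap $c\mapsto[\xi(c),0]$. A *$(C,\leq)$-difibration* is a $(C,\leq)$-dimap with the right lifting property with respect to all $i_0:X\to X\,\square_C I$, $i_0(x)=[x,0]$, where $X$ is a $(C,\leq)$-pospace. It is *trivial* if it is also a dihomotopy equivalence relative to $(C,\leq)$. A *$(C,\leq)$-dicofibration* is a $(C,\leq)$-dimap with the left lifting property with respect to all trivial $(C,\leq)$-difibrations. *Cofibration categories (Baues).* A category with an initial object $\emptyset$ and two classes of morphisms, *cofibrations* and *weak equivalences*, is a *cofibration category* if the following hold, where a *trivial cofibration* is a cofibration that is a weak equivalence. - **C1.** Isomorphisms are trivial cofibrations; composites of cofibrations are cofibrations; if two of $f$, $g$, $g\circ f$ are weak equivalences, so is the third. - **C2.** The pushout of two morphisms one of which is a cofibration exists; cofibrations and trivial cofibrations are stable under cobase change; the cobase extension of a weak equivalence along a cofibration is a weak equivalence.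 - **C3.** Every morphism factors as a cofibration followed by a weak equivalence. - **C4.** Every object admits a trivial cofibration to a *fibrant* object, i.e. to an object $Y$ such that every trivial cofibration $Y\to E$ admits a retraction. An object $X$ is *$\emptyset$-cofibrant* if $\emptyset\to X$ is a cofibration. For $X$ $\emptyset$-cofibrant and $Y$ fibrant, two morphisms $f,g:X\to Y$ are *homotopic in the cofibration category* if, for some factorization of $(\mathrm{id}_X,\mathrm{id}_X):X\amalg X\to X$ into a cofibration $j:X\amalg X\to Z$ and a weak equivalence $Z\to X$, there is a morphism $h:Z\to Y$ with $h\circ j=(f,g)$. **Theorem.** Let $(C,\leq)$ be a pospace. The category $(C,\leq)\text{-}\mathbf{poTop}$ is a cofibration category in which the cofibrations are the $(C,\leq)$-dicofibrations and the weak equivalences are the dihomotopy equivalences relative to $(C,\leq)$. All objects are fibrant and $(C,\leq,\mathrm{id}_C)$-cofibrant. Two $(C,\leq)$-dimaps are homotopic in the cofibration category $(C,\leq)\text{-}\mathbf{poTop}$ if and only if they are dihomotopic relative to $(C,\leq)$. -/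

import Mathlib

open CategoryTheory CategoryTheory.Limits

universe u v w

/-! ### Pospaces -/

/-- A pospace: a topological space with a partial order. No compatibility between the topology and
the order is required. -/
structure PoTop : Type (u + 1) where
  /-- The underlying set. -/
  carrier : Type u
  [top : TopologicalSpace carrier]
  [ord : PartialOrder carrier]

namespace PoTop

instance : CoeSort PoTop.{u} (Type u) := ⟨PoTop.carrier⟩

instance (X : PoTop.{u}) : TopologicalSpace X := X.top

instance (X : PoTop.{u}) : PartialOrder X := X.ord

/-- The category `poTop`: the morphisms are the dimaps, i.e. the continuous monotone maps. -/
instance : Category PoTop.{u} where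
  Hom X Y := X →Co Y
  id X := ContinuousOrderHom.id X
  comp f g := g.comp f

instance : ConcreteCategory PoTop.{u} (fun X Y => X →Co Y) where
  hom f := f
  ofHom f := f

/-- The pospace `(S, Δ)`: a space `S` with the diagonal (i.e. equality) as partial order. -/
def diag (S : Type u) [TopologicalSpace S] : PoTop.{u} where
  carrier := S
  ord :=
    { le := fun s t => s = t
      le_refl := fun _ => rfl
      le_trans := fun _ _ _ h h' => h.trans h'
      le_antisymm := fun _ _ h _ => h }

/-- The product pospace, with the product topology and the componentwise order. -/
def prod (X : PoTop.{u}) (Y : PoTop.{v}) : PoTop.{max u v} where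
  carrier := X × Y

/-- The pospace `(I, Δ)`, where `I = [0, 1]` is the unit interval. -/
abbrev interval : PoTop.{0} := diag unitInterval

/-! ### Pospaces under a fixed pospace

For a pospace `C`, the category of `C`-pospaces `(X, ≤, ξ)` and `C`-dimaps is `Under C`.
-/

/-- The structure dimap `ξ : C ⟶ X` of a `C`-pospace. -/
abbrev str {C : PoTop.{u}} (X : Under C) : C ⟶ X.right := X.hom

/-- Dihomotopy relative to `C`: there is a dimap `H : X × (I, Δ) ⟶ Y` with `H (x, 0) = f x`,
`H (x, 1) = g x` and `H (ξ c, t) = θ c`. -/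
def Dihomotopic {C : PoTop.{u}} {X Y : Under C} (f g : X ⟶ Y) : Prop :=
  ∃ H : X.right.prod interval ⟶ Y.right,
    (∀ x : X.right, H (x, (0 : unitInterval)) = f.right x) ∧
    (∀ x : X.right, H (x, (1 : unitInterval)) = g.right x) ∧
    (∀ (c : C) (t : unitInterval), H (str X c, t) = str Y c)

/-- The class of dihomotopy equivalences relative to `C`. -/
def dihomotopyEquivalences (C : PoTop.{u}) : MorphismProperty (Under C) :=
  fun X Y f => ∃ g : Y ⟶ X, Dihomotopic (g ≫ f) (𝟙 Y) ∧ Dihomotopic (f ≫ g) (𝟙 X)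

section Cylinder

variable {C : PoTop.{u}} (X : Under C)

/-- The equivalence relation on `X × I` which collapses `{ξ c} × I` to a point for each `c`. -/
def cylSetoid : Setoid (X.right.prod interval) where
  r p q := p = q ∨ ∃ c : C, p.1 = str X c ∧ q.1 = str X c
  iseqv :=
    { refl := fun _ => Or.inl rfl
      symm := by
        rintro p q (h | ⟨c, h, h'⟩)
        · exact Or.inl h.symm
        · exact Or.inr ⟨c, h', h⟩
      trans := by
        rintro p q r (rfl | ⟨c, h, h'⟩) (rfl | ⟨d, k, k'⟩)
        · exact Or.inl rfl
        · exact Or.inr ⟨d, k, k'⟩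
        · exact Or.inr ⟨c, h, h'⟩
        · exact Or.inr ⟨c, h, k'.trans (k.symm.trans h')⟩ }

/-- The relation on `X × I` inducing the order of the cylinder:
`(x, s) ≤ (x', s')`, or `x ≤ ξ c ≤ x'` for some `c`. -/
def cylLE (p q : X.right.prod interval) : Prop :=
  p ≤ q ∨ ∃ c : C, p.1 ≤ str X c ∧ str X c ≤ q.1

variable {X}

theorem cylLE.fst_le {p q : X.right.prod interval} (h : cylLE X p q) : p.1 ≤ q.1 := by
  rcases h with h | ⟨c, h, h'⟩
  · exact h.1
  · exact h.trans h'

theorem cylLE.trans {p q r : X.right.prod interval} (h : cylLE X p q) (k : cylLE X q r) :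
    cylLE X p r := by
  rcases h with h | ⟨c, h, h'⟩
  · rcases k with k | ⟨d, k, k'⟩
    · exact Or.inl (h.trans k)
    · exact Or.inr ⟨d, h.1.trans k, k'⟩
  · exact Or.inr ⟨c, h, h'.trans k.fst_le⟩

theorem cylLE_of_equiv {p q : X.right.prod interval} (h : (cylSetoid X).r p q) : cylLE X p q := by
  rcases h with rfl | ⟨c, h, h'⟩
  · exact Or.inl le_rfl
  · exact Or.inr ⟨c, h.le, h'.ge⟩

theorem equiv_of_cylLE {p q : X.right.prod interval} (h : cylLE X p q) (k : cylLE X q p) :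
    (cylSetoid X).r p q := by
  rcases h with h | ⟨c, h, h'⟩
  · exact Or.inl (Prod.ext (le_antisymm h.1 k.fst_le) h.2)
  · exact Or.inr ⟨c, le_antisymm h (h'.trans k.fst_le), le_antisymm (k.fst_le.trans h) h'⟩

variable (X)

/-- The relation induced by `cylLE` on the quotient `(X × I) / ∼`. -/
def cylQuotLE : _root_.Quotient (cylSetoid X) → _root_.Quotient (cylSetoid X) → Prop :=
  Quotient.lift₂ (cylLE X) (fun _ _ _ _ h k => propext
    ⟨fun l => ((cylLE_of_equiv ((cylSetoid X).symm h)).trans l).trans (cylLE_of_equiv k),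
     fun l => ((cylLE_of_equiv h).trans l).trans (cylLE_of_equiv ((cylSetoid X).symm k))⟩)

/-- The underlying pospace of the cylinder on `X`: the quotient space `(X × I) / ∼` with the order
`[x, s] ≤ [x', s']` iff `(x, s) ≤ (x', s')` or `x ≤ ξ c ≤ x'` for some `c`. -/
def cylPospace : PoTop.{u} where
  carrier := _root_.Quotient (cylSetoid X)
  top := inferInstanceAs (TopologicalSpace (_root_.Quotient (cylSetoid X)))
  ord :=
    { le := cylQuotLE X
      lt := fun a b => cylQuotLE X a b ∧ ¬ cylQuotLE X b a
      lt_iff_le_not_ge := fun _ _ => Iff.rfl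
      le_refl := by
        rintro ⟨p⟩
        exact Or.inl le_rfl
      le_trans := by
        rintro ⟨p⟩ ⟨q⟩ ⟨r⟩ h k
        exact cylLE.trans h k
      le_antisymm := by
        rintro ⟨p⟩ ⟨q⟩ h k
        exact Quotient.sound (equiv_of_cylLE h k) }

/-- The quotient dimap `X × (I, Δ) ⟶ X □ I`, `(x, t) ↦ [x, t]`. -/
def cylMk : X.right.prod interval ⟶ cylPospace X :=
  ({ toFun := fun p => Quotient.mk (cylSetoid X) p
     monotone' := fun _ _ h => Or.inl h
     continuous_toFun := continuous_quotient_mk' } : X.right.prod interval →Co cylPospace X)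

/-- The dimap `X ⟶ X × (I, Δ)`, `x ↦ (x, t)`. -/
def atTime (t : unitInterval) : X.right ⟶ X.right.prod interval :=
  ({ toFun := fun x => (x, t)
     monotone' := fun _ _ h => ⟨h, rfl⟩
     continuous_toFun := Continuous.prodMk continuous_id continuous_const } :
    X.right →Co X.right.prod interval)

/-- The cylinder `X □ I` on a `C`-pospace `X`, with structure dimap `c ↦ [ξ c, 0]`
(which equals `[ξ c, t]` for every `t`). -/
def cylinder : Under C :=
  Under.mk (str X ≫ atTime X 0 ≫ cylMk X)

/-- The `C`-dimap `i₀ : X ⟶ X □ I`, `x ↦ [x, 0]`. -/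
def cylι₀ : X ⟶ cylinder X :=
  Under.homMk (atTime X 0 ≫ cylMk X) rfl

end Cylinder

/-- `C`-difibrations: the `C`-dimaps with the right lifting property with respect to all the
`C`-dimaps `i₀ : X ⟶ X □ I`. -/
def difibrations (C : PoTop.{u}) : MorphismProperty (Under C) :=
  fun _ _ p => ∀ X : Under C, HasLiftingProperty (cylι₀ X) p

/-- Trivial `C`-difibrations: `C`-difibrations that are dihomotopy equivalences relative to `C`. -/
def trivialDifibrations (C : PoTop.{u}) : MorphismProperty (Under C) :=
  difibrations C ⊓ dihomotopyEquivalences C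

/-- `C`-dicofibrations: the `C`-dimaps with the left lifting property with respect to the trivial
`C`-difibrations. -/
def dicofibrations (C : PoTop.{u}) : MorphismProperty (Under C) :=
  (trivialDifibrations C).llp

end PoTop

/-! ### Cofibration categories in the sense of Baues -/

namespace Baues

variable {𝒞 : Type v} [Category.{w} 𝒞]

/-- An object `X` is fibrant if every trivial cofibration `X ⟶ E` admits a retraction. -/
def IsFibrant (Cof W : MorphismProperty 𝒞) (X : 𝒞) : Prop :=
  ∀ ⦃E : 𝒞⦄ (i : X ⟶ E), Cof i → W i → ∃ r : E ⟶ X, i ≫ r = 𝟙 X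

/-- For an initial object `Z`, an object `X` is `Z`-cofibrant if the initial morphism `Z ⟶ X` is a
cofibration. -/
def IsCofibrant (Cof : MorphismProperty 𝒞) {Z : 𝒞} (hZ : IsInitial Z) (X : 𝒞) : Prop :=
  Cof (hZ.to X)

/-- A category with an initial object and with two classes of morphisms, the cofibrations `Cof` and
the weak equivalences `W`, is a cofibration category if it satisfies the axioms C1 – C4. -/
structure IsCofibrationCategory (Cof W : MorphismProperty 𝒞) : Prop where
  /-- There is an initial object. -/
  hasInitial : HasInitial 𝒞
  /-- C1: isomorphisms are cofibrations. -/
  cof_of_iso : ∀ ⦃X Y : 𝒞⦄ (f : X ⟶ Y), IsIso f → Cof f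
  /-- C1: isomorphisms are weak equivalences. -/
  weq_of_iso : ∀ ⦃X Y : 𝒞⦄ (f : X ⟶ Y), IsIso f → W f
  /-- C1: cofibrations are closed under composition. -/
  cof_comp : ∀ ⦃X Y Z : 𝒞⦄ (f : X ⟶ Y) (g : Y ⟶ Z), Cof f → Cof g → Cof (f ≫ g)
  /-- C1: if two of `f`, `g` and `f ≫ g` are weak equivalences, then so is the third. -/
  weq_two_of_three : W.HasTwoOutOfThreeProperty
  /-- C2: the pushout of two morphisms one of which is a cofibration exists. -/
  hasPushout : ∀ ⦃A B X : 𝒞⦄ (f : A ⟶ B) (i : A ⟶ X), Cof i → HasPushout f i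
  /-- C2: cofibrations are stable under cobase change. -/
  cof_cobase : ∀ ⦃A B X P : 𝒞⦄ ⦃f : A ⟶ B⦄ ⦃i : A ⟶ X⦄ ⦃i' : B ⟶ P⦄ ⦃f' : X ⟶ P⦄,
    IsPushout f i i' f' → Cof i → Cof i'
  /-- C2: trivial cofibrations are stable under cobase change. -/
  trivialCof_cobase : ∀ ⦃A B X P : 𝒞⦄ ⦃f : A ⟶ B⦄ ⦃i : A ⟶ X⦄ ⦃i' : B ⟶ P⦄ ⦃f' : X ⟶ P⦄,
    IsPushout f i i' f' → Cof i → W i → Cof i' ∧ W i'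
  /-- C2: the cobase extension of a weak equivalence along a cofibration is a weak equivalence. -/
  weq_cobase : ∀ ⦃A B X P : 𝒞⦄ ⦃f : A ⟶ B⦄ ⦃i : A ⟶ X⦄ ⦃i' : B ⟶ P⦄ ⦃f' : X ⟶ P⦄,
    IsPushout f i i' f' → Cof i → W f → W f'
  /-- C3: every morphism is a cofibration followed by a weak equivalence. -/
  factorization : ∀ ⦃X Y : 𝒞⦄ (f : X ⟶ Y),
    ∃ (Z : 𝒞) (j : X ⟶ Z) (p : Z ⟶ Y), Cof j ∧ W p ∧ j ≫ p = f
  /-- C4: every object admits a trivial cofibration to a fibrant object. -/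
  fibrant_model : ∀ X : 𝒞, ∃ (Y : 𝒞) (i : X ⟶ Y), Cof i ∧ W i ∧ IsFibrant Cof W Y

/-- The homotopy relation under `A` of a cofibration category, for morphisms `f g : X ⟶ Y` that
agree on a cofibration `i : A ⟶ X` and have a fibrant target `Y`: for some factorization of the
folding morphism `X ∪_A X ⟶ X` into a cofibration `j : X ∪_A X ⟶ Z` and a weak equivalence
`p : Z ⟶ X`, the morphism `(f, g) : X ∪_A X ⟶ Y` extends over `j`. Here `X ∪_A X` is any pushout `Q`
of `i` and `i`, with canonical morphisms `k₀ k₁ : X ⟶ Q`. -/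
def HomotopicUnder (Cof W : MorphismProperty 𝒞) {A X Y : 𝒞} (i : A ⟶ X) (f g : X ⟶ Y) : Prop :=
  ∃ (Q : 𝒞) (k₀ k₁ : X ⟶ Q) (_ : IsPushout i i k₀ k₁) (Z : 𝒞) (j : Q ⟶ Z) (p : Z ⟶ X),
    Cof j ∧ W p ∧ k₀ ≫ j ≫ p = 𝟙 X ∧ k₁ ≫ j ≫ p = 𝟙 X ∧
      ∃ h : Z ⟶ Y, k₀ ≫ j ≫ h = f ∧ k₁ ≫ j ≫ h = g

/-- The homotopy relation of a cofibration category: homotopy under an initial object `Z`. -/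
def Homotopic (Cof W : MorphismProperty 𝒞) {Z : 𝒞} (hZ : IsInitial Z) {X Y : 𝒞}
    (f g : X ⟶ Y) : Prop :=
  HomotopicUnder Cof W (hZ.to X) f g

end Baues

namespace PoTop

/-! ### Dimaps under `C` and parametrised families of them -/

variable {C : PoTop.{u}}

/-! The interval carries the equality order, so a dihomotopy is a continuous family of dimaps.
Classical homotopy constructions that only reparametrise, concatenate or lift such families stay
monotone at each time, and the proof is Hurewicz-style homotopy theory under `C`.

Everything rests on trivial difibrations. Such a map has a strict section and a vertical deformation
of its total space onto that section (`exists_section`), so paths in the base lift with both end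
points prescribed (`exists_path`). Hence every object is cofibrant, and both the ends of a cylinder
and the free end of a mapping cylinder are dicofibrations; the latter gives C3.

Conversely, end point evaluation on the mapping path space of an equivalence is a trivial
difibration. Lifting against it shows that a trivial dicofibration is a strong deformation retract,
so that all objects are fibrant and trivial cofibrations survive cobase change. Lifting against
evaluation on a path space gives the dihomotopy extension property, from which a double mapping
cylinder argument derives the cobase axiom for weak equivalences. -/

theorem continuous_hom {X Y : PoTop.{u}} (f : X ⟶ Y) : Continuous f :=
  ContinuousOrderHom.continuous_toFun (f : X →Co Y)

theorem monotone_hom {X Y : PoTop.{u}} (f : X ⟶ Y) : Monotone f :=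
  (f : X →Co Y).monotone'

/-- The `C`-dimap with a given underlying function. -/
def mkHom {X Y : Under C} (f : X.right → Y.right) (hf : Continuous f) (hm : Monotone f)
    (hs : ∀ c, f (str X c) = str Y c) : X ⟶ Y :=
  Under.homMk ({ toFun := f, monotone' := hm, continuous_toFun := hf } : X.right →Co Y.right)
    (by ext c; exact hs c)

@[simp]
theorem mkHom_apply {X Y : Under C} (f : X.right → Y.right) (hf : Continuous f) (hm : Monotone f)
    (hs : ∀ c, f (str X c) = str Y c) (x : X.right) : (mkHom f hf hm hs).right x = f x := rfl

@[simp]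
theorem right_comp_apply {X Y Z : Under C} (f : X ⟶ Y) (g : Y ⟶ Z) (x : X.right) :
    (f ≫ g).right x = g.right (f.right x) := rfl

@[simp]
theorem right_id_apply {X : Under C} (x : X.right) : (𝟙 X : X ⟶ X).right x = x := rfl

@[simp]
theorem right_str {X Y : Under C} (f : X ⟶ Y) (c : C) : f.right (str X c) = str Y c :=
  ConcreteCategory.congr_hom (Under.w f) c

theorem hom_congr {X Y : Under C} {f g : X ⟶ Y} (h : f = g) (x : X.right) :
    f.right x = g.right x := by rw [h]

theorem hom_ext {X Y : Under C} {f g : X ⟶ Y} (h : ∀ x, f.right x = g.right x) : f = g := by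
  ext x
  exact h x

/-- A family `F` of functions `X → Y` indexed by `T` which is jointly continuous and consists of
`C`-dimaps. -/
structure IsDifamily {X Y : Under C} {T : Type*} [TopologicalSpace T]
    (F : X.right → T → Y.right) : Prop where
  continuous : Continuous (fun q : X.right × T => F q.1 q.2)
  monotone : ∀ t, Monotone (fun x => F x t)
  str : ∀ c t, F (str X c) t = str Y c

namespace IsDifamily

variable {X Y Z : Under C} {S T : Type*} [TopologicalSpace T] [TopologicalSpace S]

theorem const (f : X ⟶ Y) : IsDifamily (T := T) (fun x _ => f.right x) :=
  ⟨(continuous_hom f.right).comp continuous_fst, fun _ => monotone_hom f.right,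
    fun c _ => right_str f c⟩

theorem comp {F : Y.right → T → Z.right} (hF : IsDifamily F) (f : X ⟶ Y) :
    IsDifamily (fun x t => F (f.right x) t) :=
  ⟨hF.continuous.comp (((continuous_hom f.right).comp continuous_fst).prodMk continuous_snd),
    fun t => (hF.monotone t).comp (monotone_hom f.right),
    fun c t => by rw [right_str, hF.str]⟩

theorem postcomp {F : X.right → T → Y.right} (hF : IsDifamily F) (g : Y ⟶ Z) :
    IsDifamily (fun x t => g.right (F x t)) :=
  ⟨(continuous_hom g.right).comp hF.continuous,
    fun t => (monotone_hom g.right).comp (hF.monotone t),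
    fun c t => by rw [hF.str, right_str]⟩

theorem reparam {F : X.right → T → Y.right} (hF : IsDifamily F) {r : S → T} (hr : Continuous r) :
    IsDifamily (fun x s => F x (r s)) :=
  ⟨hF.continuous.comp (continuous_fst.prodMk (hr.comp continuous_snd)),
    fun s => hF.monotone (r s), fun c s => hF.str c (r s)⟩

theorem bind {F : X.right → T → Y.right} {G : Y.right → T → Z.right} (hF : IsDifamily F)
    (hG : IsDifamily G) : IsDifamily (fun x t => G (F x t) t) :=
  ⟨hG.continuous.comp (hF.continuous.prodMk continuous_snd),
    fun t => (hG.monotone t).comp (hF.monotone t), fun c t => by rw [hF.str, hG.str]⟩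

/-- Two families that agree where `a = b` are glued along the sign of `b - a`. -/
theorem ite_le {F G : X.right → T → Y.right} (hF : IsDifamily F) (hG : IsDifamily G)
    {a b : T → ℝ} (ha : Continuous a) (hb : Continuous b)
    (h : ∀ x t, a t = b t → F x t = G x t) :
    IsDifamily (fun x t => if a t ≤ b t then F x t else G x t) where
  continuous := Continuous.if_le hF.continuous hG.continuous (ha.comp continuous_snd)
    (hb.comp continuous_snd) (fun q hq => h q.1 q.2 hq)
  monotone t := by
    by_cases ht : a t ≤ b t
    · simpa [ht] using hF.monotone t
    · simpa [ht] using hG.monotone t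
  str c t := by split_ifs; exacts [hF.str c t, hG.str c t]

/-- The member of a family at a given index. -/
def at' {F : X.right → T → Y.right} (hF : IsDifamily F) (t : T) : X ⟶ Y :=
  mkHom (fun x => F x t) (hF.continuous.comp (continuous_id.prodMk continuous_const))
    (hF.monotone t) (fun c => hF.str c t)

@[simp]
theorem at'_apply {F : X.right → T → Y.right} (hF : IsDifamily F) (t : T) (x : X.right) :
    (hF.at' t).right x = F x t := rfl

end IsDifamily

/-- A point of the unit interval obtained by clamping a real number. -/
noncomputable abbrev clamp (r : ℝ) : unitInterval := Set.projIcc 0 1 zero_le_one r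

theorem continuous_clamp : Continuous clamp := continuous_projIcc

@[simp]
theorem clamp_coe (t : unitInterval) : clamp t = t := Set.projIcc_val _ t

theorem clamp_of_le_zero {r : ℝ} (h : r ≤ 0) : clamp r = 0 := Set.projIcc_of_le_left _ h

theorem clamp_of_one_le {r : ℝ} (h : 1 ≤ r) : clamp r = 1 := Set.projIcc_of_right_le _ h

theorem coe_clamp {r : ℝ} (h : r ∈ Set.Icc (0 : ℝ) 1) : (clamp r : ℝ) = r := by
  rw [clamp, Set.projIcc_of_mem _ h]

/-! ### Dihomotopy -/

/-- Comparable points of `X × (I, Δ)` have equal times, so monotonicity of `H` is monotonicity at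
each time. -/
theorem dihomotopic_iff {X Y : Under C} {f g : X ⟶ Y} :
    Dihomotopic f g ↔ ∃ F : X.right → unitInterval → Y.right, IsDifamily F ∧
      (∀ x, F x 0 = f.right x) ∧ ∀ x, F x 1 = g.right x := by
  constructor
  · rintro ⟨H, h0, h1, hs⟩
    exact ⟨fun x t => H (x, t), ⟨continuous_hom H, fun t x y h => monotone_hom H ⟨h, rfl⟩, hs⟩,
      h0, h1⟩
  · rintro ⟨F, hF, h0, h1⟩
    refine ⟨({ toFun := fun q => F q.1 q.2, monotone' := ?_, continuous_toFun := hF.continuous } :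
      X.right.prod interval →Co Y.right), h0, h1, hF.str⟩
    rintro ⟨x, t⟩ ⟨y, s⟩ ⟨h, h'⟩
    obtain rfl : t = s := h'
    exact hF.monotone t h

theorem IsDifamily.dihomotopic {X Y : Under C} {F : X.right → unitInterval → Y.right}
    (hF : IsDifamily F) : Dihomotopic (hF.at' 0) (hF.at' 1) :=
  dihomotopic_iff.2 ⟨F, hF, fun _ => rfl, fun _ => rfl⟩

namespace Dihomotopic

variable {X Y Z : Under C}

theorem refl (f : X ⟶ Y) : Dihomotopic f f :=
  dihomotopic_iff.2 ⟨_, IsDifamily.const f, fun _ => rfl, fun _ => rfl⟩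

theorem symm {f g : X ⟶ Y} (h : Dihomotopic f g) : Dihomotopic g f := by
  obtain ⟨F, hF, h0, h1⟩ := dihomotopic_iff.1 h
  exact dihomotopic_iff.2 ⟨_, hF.reparam unitInterval.continuous_symm, by simpa, by simpa⟩

theorem trans {f g h : X ⟶ Y} (H : Dihomotopic f g) (K : Dihomotopic g h) : Dihomotopic f h := by
  obtain ⟨F, hF, h0, h1⟩ := dihomotopic_iff.1 H
  obtain ⟨G, hG, k0, k1⟩ := dihomotopic_iff.1 K
  refine dihomotopic_iff.2 ⟨fun x t => if (t : ℝ) ≤ 1 / 2 then F x (clamp (2 * t)) else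
    G x (clamp (2 * t - 1)), IsDifamily.ite_le (hF.reparam (continuous_clamp.comp (by fun_prop)))
    (hG.reparam (continuous_clamp.comp (by fun_prop))) (by fun_prop) (by fun_prop) ?_, ?_, ?_⟩
  · intro x t ht
    simp only [Function.comp_apply]
    rw [ht, clamp_of_one_le (by norm_num), clamp_of_le_zero (by norm_num), h1, k0]
  · intro x
    simp [h0]
  · intro x
    have : ¬ ((1 : unitInterval) : ℝ) ≤ 1 / 2 := by norm_num
    simp only [if_neg this]
    rw [clamp_of_one_le (by norm_num), k1]

theorem postcomp {f g : X ⟶ Y} (H : Dihomotopic f g) (k : Y ⟶ Z) :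
    Dihomotopic (f ≫ k) (g ≫ k) := by
  obtain ⟨F, hF, h0, h1⟩ := dihomotopic_iff.1 H
  exact dihomotopic_iff.2 ⟨_, hF.postcomp k, by simp [h0], by simp [h1]⟩

theorem precomp {f g : Y ⟶ Z} (H : Dihomotopic f g) (k : X ⟶ Y) :
    Dihomotopic (k ≫ f) (k ≫ g) := by
  obtain ⟨F, hF, h0, h1⟩ := dihomotopic_iff.1 H
  exact dihomotopic_iff.2 ⟨_, hF.comp k, by simp [h0], by simp [h1]⟩

end Dihomotopic

/-- Dihomotopy relative to `C` as a relation on the morphisms of `Under C`. -/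
def dihomotopyRel (C : PoTop.{u}) : HomRel (Under C) := fun _ _ => Dihomotopic

instance (C : PoTop.{u}) : Congruence (dihomotopyRel C) where
  equivalence := ⟨Dihomotopic.refl, Dihomotopic.symm, Dihomotopic.trans⟩
  comp_left k _ _ h := h.precomp k
  comp_right k h := h.postcomp k

theorem quotient_map_eq_iff {X Y : Under C} (f g : X ⟶ Y) :
    (Quotient.functor (dihomotopyRel C)).map f = (Quotient.functor (dihomotopyRel C)).map g ↔
      Dihomotopic f g :=
  Quotient.functor_map_eq_iff _ f g

/-- Equivalences are the maps inverted in the quotient category of dihomotopy classes; two out of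
three is then inherited from isomorphisms. -/
theorem dihomotopyEquivalences_eq (C : PoTop.{u}) : dihomotopyEquivalences C =
    (MorphismProperty.isomorphisms _).inverseImage (Quotient.functor (dihomotopyRel C)) := by
  ext X Y f
  constructor
  · rintro ⟨g, h, k⟩
    refine ⟨(Quotient.functor (dihomotopyRel C)).map g, ?_, ?_⟩
    · rw [← CategoryTheory.Functor.map_comp, ← CategoryTheory.Functor.map_id, quotient_map_eq_iff]
      exact k
    · rw [← CategoryTheory.Functor.map_comp, ← CategoryTheory.Functor.map_id, quotient_map_eq_iff]
      exact h
  · rintro ⟨g, h, k⟩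
    obtain ⟨g, rfl⟩ := (Quotient.functor (dihomotopyRel C)).map_surjective g
    rw [← CategoryTheory.Functor.map_comp, ← CategoryTheory.Functor.map_id,
      quotient_map_eq_iff] at h k
    exact ⟨g, k, h⟩

instance (C : PoTop.{u}) : (dihomotopyEquivalences C).HasTwoOutOfThreeProperty := by
  rw [dihomotopyEquivalences_eq]
  infer_instance

theorem dihomotopyEquivalences_of_isIso {X Y : Under C} (f : X ⟶ Y) [IsIso f] :
    dihomotopyEquivalences C f :=
  ⟨inv f, by rw [IsIso.inv_hom_id]; exact .refl _, by rw [IsIso.hom_inv_id]; exact .refl _⟩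

/-! ### Maps out of cylinders and into path objects -/

/-- The `C`-dimap `X □ I ⟶ Y` corresponding to a dihomotopy. -/
def cylDesc {X Y : Under C} {F : X.right → unitInterval → Y.right} (hF : IsDifamily F) :
    cylinder X ⟶ Y :=
  mkHom (X := cylinder X)
    (_root_.Quotient.lift (fun q => F q.1 q.2) (by
      rintro ⟨x, s⟩ ⟨y, t⟩ (h | ⟨c, h, k⟩)
      · rw [h]
      · dsimp only at h k ⊢
        rw [h, k]
        exact (hF.str c s).trans (hF.str c t).symm))
    (hF.continuous.quotient_lift _)
    (by
      rintro ⟨x, s⟩ ⟨y, t⟩ (⟨h, h'⟩ | ⟨c, h, k⟩)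
      · obtain rfl : s = t := h'
        exact hF.monotone s h
      · refine (hF.monotone s h).trans (le_trans (le_of_eq ?_) (hF.monotone t k))
        exact (hF.str c s).trans (hF.str c t).symm)
    (fun c => hF.str c 0)

/-- The point `[x, t]` of the cylinder. -/
def cylPt {X : Under C} (x : X.right) (t : unitInterval) : (cylinder X).right := cylMk X (x, t)

theorem isDifamily_cylPt (X : Under C) : IsDifamily (X := X) (cylPt (X := X)) :=
  ⟨continuous_hom (cylMk X), fun _ _ _ h => monotone_hom (cylMk X) ⟨h, rfl⟩,
    fun c _ => Quotient.sound (Or.inr ⟨c, rfl, rfl⟩)⟩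

theorem cylinder_hom_ext {X Y : Under C} {f g : cylinder X ⟶ Y}
    (h : ∀ x t, f.right (cylPt x t) = g.right (cylPt x t)) : f = g := by
  apply hom_ext
  rintro ⟨x, t⟩
  exact h x t

/-- The path object of `Y`: paths in `Y` with the pointwise order. -/
def pathObj (Y : Under C) : Under C :=
  Under.mk (Y := { carrier := C(unitInterval, Y.right) })
    ({ toFun := fun c => ContinuousMap.const _ (str Y c)
       monotone' := fun _ _ h _ => monotone_hom (str Y) h
       continuous_toFun := ContinuousMap.continuous_const'.comp (continuous_hom (str Y)) } :
      C →Co ({ carrier := C(unitInterval, Y.right) } : PoTop))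

/-- The `C`-dimap to the path object corresponding to a dihomotopy. -/
def toPathObj {X Y : Under C} {F : X.right → unitInterval → Y.right} (hF : IsDifamily F) :
    X ⟶ pathObj Y :=
  mkHom (Y := pathObj Y)
    (ContinuousMap.curry ⟨fun q : X.right × unitInterval => F q.1 q.2, hF.continuous⟩)
    (ContinuousMap.continuous _) (fun _ _ h t => hF.monotone t h)
    (fun c => ContinuousMap.ext (fun t => hF.str c t))

/-- Evaluation is jointly continuous because `I` is locally compact. This turns maps into the path
object back into dihomotopies. -/
theorem isDifamily_pathObj (Y : Under C) :
    IsDifamily (X := pathObj Y) (Y := Y)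
      (fun (γ : C(unitInterval, Y.right)) (t : unitInterval) => γ t) :=
  ⟨(continuous_eval : Continuous fun q : C(unitInterval, Y.right) × unitInterval => q.1 q.2),
    fun t _ _ h => h t, fun _ _ => rfl⟩

/-- Dihomotopies that agree on `A` are glued along a pushout. -/
theorem exists_isDifamily_of_isPushout {A B X P Y : Under C} {f : A ⟶ B} {i : A ⟶ X} {i' : B ⟶ P}
    {f' : X ⟶ P} (sq : IsPushout f i i' f') {F : B.right → unitInterval → Y.right}
    {G : X.right → unitInterval → Y.right} (hF : IsDifamily F) (hG : IsDifamily G)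
    (h : ∀ a t, F (f.right a) t = G (i.right a) t) :
    ∃ K : P.right → unitInterval → Y.right, IsDifamily K ∧
      (∀ b t, K (i'.right b) t = F b t) ∧ ∀ x t, K (f'.right x) t = G x t := by
  -- Read as maps into the path object, the families glue by the universal property of `P`; no
  -- statement about the topology of `P × I` is needed.
  have w : f ≫ toPathObj hF = i ≫ toPathObj hG :=
    hom_ext fun a => ContinuousMap.ext fun t => h a t
  refine ⟨_, (isDifamily_pathObj Y).comp (sq.desc _ _ w), fun b t => ?_, fun x t => ?_⟩
  · exact congrArg (fun γ : C(unitInterval, Y.right) => γ t)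
      (hom_congr (sq.inl_desc _ _ w) b)
  · exact congrArg (fun γ : C(unitInterval, Y.right) => γ t)
      (hom_congr (sq.inr_desc _ _ w) x)

/-! ### Mapping path spaces -/

/-- The mapping path space of `f : A ⟶ B`: pairs of a point `a` of `A` and a path in `B` that starts
at `f a`. -/
def mapPath {A B : Under C} (f : A ⟶ B) : Under C :=
  Under.mk (Y := { carrier := {q : A.right × C(unitInterval, B.right) // q.2 0 = f.right q.1} })
    ({ toFun := fun c => ⟨(str A c, ContinuousMap.const _ (str B c)), (right_str f c).symm⟩
       monotone' := fun _ _ h => ⟨monotone_hom (str A) h, fun _ => monotone_hom (str B) h⟩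
       continuous_toFun := ((continuous_hom (str A)).prodMk
        (ContinuousMap.continuous_const'.comp (continuous_hom (str B)))).subtype_mk _ } :
      C →Co ({ carrier := {q : A.right × C(unitInterval, B.right) // q.2 0 = f.right q.1} } :
        PoTop))

namespace mapPath

variable {A B X : Under C} (f : A ⟶ B)

/-- The starting point, as a point of `A`. -/
def fst : mapPath f ⟶ A :=
  mkHom (X := mapPath f)
    (fun q : {q : A.right × C(unitInterval, B.right) // q.2 0 = f.right q.1} => q.1.1)
    (continuous_fst.comp continuous_subtype_val) (fun _ _ h => h.1) (fun _ => rfl)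

/-- The path underlying a point of the mapping path space. -/
def path (q : (mapPath f).right) (t : unitInterval) : B.right :=
  (show {q : A.right × C(unitInterval, B.right) // q.2 0 = f.right q.1} from q).1.2 t

theorem isDifamily_path : IsDifamily (X := mapPath f) (path f) where
  continuous :=
    (continuous_eval : Continuous fun q : C(unitInterval, B.right) × unitInterval => q.1 q.2).comp
      ((continuous_snd.comp (continuous_subtype_val.comp continuous_fst)).prodMk continuous_snd)
  monotone t _ _ h := h.2 t
  str _ _ := rfl

theorem path_zero (q : (mapPath f).right) : path f q 0 = f.right ((fst f).right q) :=
  (show {q : A.right × C(unitInterval, B.right) // q.2 0 = f.right q.1} from q).2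

/-- The end point of the path. -/
def ev₁ : mapPath f ⟶ B := (isDifamily_path f).at' 1

theorem ev₁_apply (q : (mapPath f).right) : (ev₁ f).right q = path f q 1 := rfl

theorem exists_family {T : Type*} [TopologicalSpace T] {a : X.right → T → A.right}
    (ha : IsDifamily a) {β : X.right → T × unitInterval → B.right} (hβ : IsDifamily β)
    (h : ∀ x t, β x (t, 0) = f.right (a x t)) :
    ∃ F : X.right → T → (mapPath f).right, IsDifamily F ∧
      (∀ x t, (fst f).right (F x t) = a x t) ∧ ∀ x t u, path f (F x t) u = β x (t, u) := by
  have hc : Continuous fun q : (X.right × T) × unitInterval => β q.1.1 (q.1.2, q.2) :=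
    hβ.continuous.comp ((continuous_fst.comp continuous_fst).prodMk
      ((continuous_snd.comp continuous_fst).prodMk continuous_snd))
  let G : C(X.right × T, C(unitInterval, B.right)) := ContinuousMap.curry ⟨_, hc⟩
  refine ⟨fun x t => (⟨(a x t, G (x, t)), h x t⟩ :
    {q : A.right × C(unitInterval, B.right) // q.2 0 = f.right q.1}), ⟨?_, ?_, ?_⟩,
    fun _ _ => rfl, fun _ _ _ => rfl⟩
  · exact (ha.continuous.prodMk G.continuous).subtype_mk _
  · exact fun t _ _ h => ⟨ha.monotone t h, fun u => hβ.monotone (t, u) h⟩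
  · exact fun c t => Subtype.ext (Prod.ext (ha.str c t)
      (ContinuousMap.ext fun u => hβ.str c (t, u)))

theorem ext {q r : (mapPath f).right} (h : (fst f).right q = (fst f).right r)
    (h' : ∀ t, path f q t = path f r t) : q = r :=
  Subtype.ext (Prod.ext h (ContinuousMap.ext h'))

theorem exists_hom {a : X ⟶ A} {β : X.right → unitInterval → B.right} (hβ : IsDifamily β)
    (h : ∀ x, β x 0 = f.right (a.right x)) :
    ∃ k : X ⟶ mapPath f, k ≫ fst f = a ∧ ∀ x t, path f (k.right x) t = β x t := by
  obtain ⟨F, hF, h1, h2⟩ := exists_family (T := Unit) f (IsDifamily.const a)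
    (hβ.reparam continuous_snd) (fun x _ => h x)
  exact ⟨hF.at' (), hom_ext fun x => h1 x (), fun x t => h2 x () t⟩

/-- The map to the mapping path space with constant paths. -/
theorem exists_const : ∃ k : A ⟶ mapPath f, k ≫ fst f = 𝟙 A ∧
    (∀ a t, path f (k.right a) t = f.right a) ∧ k ≫ ev₁ f = f ∧ dihomotopyEquivalences C k := by
  obtain ⟨k, hk, hk'⟩ := exists_hom f (a := 𝟙 A) (IsDifamily.const f) (fun _ => rfl)
  refine ⟨k, hk, hk', hom_ext fun a => hk' a 1, fst f, ?_, by rw [hk]; exact .refl _⟩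
  -- Each path shrinks to its starting point by `u ↦ path (t * u)`.
  obtain ⟨F, hF, h1, h2⟩ := exists_family f (IsDifamily.const (T := unitInterval) (fst f))
    ((isDifamily_path f).reparam (S := unitInterval × unitInterval) (r := fun q => q.1 * q.2)
      (by fun_prop)) (by simp [path_zero])
  refine dihomotopic_iff.2 ⟨F, hF, fun q => ext f ?_ fun t => ?_, fun q => ext f ?_ fun t => ?_⟩
  · rw [h1]
    exact (hom_congr hk _).symm
  · rw [h2, zero_mul, path_zero]
    exact (hk' _ t).symm
  · rw [h1]; rfl
  · rw [h2, one_mul]; rfl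

end mapPath

/-! ### Difibrations -/

theorem difibrations_iff {E B : Under C} {p : E ⟶ B} : difibrations C p ↔
    ∀ (X : Under C) (f : X ⟶ E) (H : X.right → unitInterval → B.right), IsDifamily H →
      (∀ x, H x 0 = p.right (f.right x)) → ∃ L : X.right → unitInterval → E.right, IsDifamily L ∧
        (∀ x, L x 0 = f.right x) ∧ ∀ x t, p.right (L x t) = H x t := by
  constructor
  · intro hp X f H hH h0
    have sq : CommSq f (cylι₀ X) p (cylDesc hH) := ⟨hom_ext fun x => (h0 x).symm⟩
    have := hp X
    refine ⟨_, (isDifamily_cylPt X).postcomp sq.lift, fun x => ?_, fun x t => ?_⟩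
    · exact hom_congr sq.fac_left x
    · exact hom_congr sq.fac_right
        (cylPt x t)
  · intro h X
    refine ⟨fun {f b} sq => ⟨?_⟩⟩
    obtain ⟨L, hL, h0, h1⟩ := h X f _ ((isDifamily_cylPt X).postcomp b)
      (fun x => (hom_congr sq.w x).symm)
    exact ⟨⟨cylDesc hL, hom_ext h0, cylinder_hom_ext h1⟩⟩

/-- Lifting with an extra parameter space `T`. The defining property concerns `C`-pospaces only, so
it is applied once to the universal lifting problem on `mapPath p`; every parametrised problem is
pulled back from that one. -/
theorem difibrations.exists_lift {E B X : Under C} {p : E ⟶ B} (hp : difibrations C p)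
    {T : Type*} [TopologicalSpace T] {f : X.right → T → E.right} (hf : IsDifamily f)
    {H : X.right → T × unitInterval → B.right} (hH : IsDifamily H)
    (h0 : ∀ x t, H x (t, 0) = p.right (f x t)) :
    ∃ L : X.right → T × unitInterval → E.right, IsDifamily L ∧ (∀ x t, L x (t, 0) = f x t) ∧
      ∀ x q, p.right (L x q) = H x q := by
  obtain ⟨F, hF, hF1, hF2⟩ := mapPath.exists_family p hf hH h0
  obtain ⟨L, hL, hL0, hL1⟩ := difibrations_iff.1 hp _ (mapPath.fst p) _
    (mapPath.isDifamily_path p) (mapPath.path_zero p)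
  refine ⟨fun x q => L (F x q.1) q.2, (hF.reparam continuous_fst).bind
    (G := fun n q => L n q.2) (hL.reparam continuous_snd), fun x t => ?_, fun x q => ?_⟩
  · simp only [hL0, hF1]
  · simp only [hL1, hF2]

/-- A motion `H` of the end point lifts by appending its track: at time `u` the path follows the old
one and then `H` on `[0, u]`, at speed `1 + u`. The starting point never moves. -/
theorem difibrations_ev₁ {A B : Under C} (f : A ⟶ B) : difibrations C (mapPath.ev₁ f) := by
  refine difibrations_iff.2 fun X g H hH h0 => ?_
  have hγ := (mapPath.isDifamily_path f).comp g
  obtain ⟨L, hL, h1, h2⟩ := mapPath.exists_family f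
    (IsDifamily.const (T := unitInterval) (g ≫ mapPath.fst f))
    (IsDifamily.ite_le
      (hγ.reparam (S := unitInterval × unitInterval)
        (r := fun q => clamp ((q.2 : ℝ) * (1 + (q.1 : ℝ)))) (continuous_clamp.comp (by fun_prop)))
      (hH.reparam (r := fun q => clamp ((q.2 : ℝ) * (1 + (q.1 : ℝ)) - 1))
        (continuous_clamp.comp (by fun_prop)))
      (a := fun q => (q.2 : ℝ) * (1 + (q.1 : ℝ))) (b := fun _ => 1) (by fun_prop) (by fun_prop)
      (fun x q hq => by
        rw [hq, sub_self, clamp_of_one_le le_rfl, clamp_of_le_zero le_rfl, h0]; rfl))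
    (fun x u => by simp [mapPath.path_zero])
  refine ⟨L, hL, fun x => mapPath.ext f (h1 x 0) fun t => ?_, fun x u => ?_⟩
  · simp [h2, t.2.2]
  · rw [mapPath.ev₁_apply, h2]
    by_cases hu : (u : ℝ) ≤ 0
    · have hu' : u = 0 := Subtype.ext (le_antisymm hu u.2.1)
      simp [hu', h0, mapPath.ev₁_apply]
    · simp [hu]

theorem trivialDifibrations_ev₁ {A B : Under C} {f : A ⟶ B} (hf : dihomotopyEquivalences C f) :
    trivialDifibrations C (mapPath.ev₁ f) := by
  obtain ⟨k, -, -, hk, hw⟩ := mapPath.exists_const f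
  refine ⟨difibrations_ev₁ f, ?_⟩
  rw [← hk] at hf
  exact (dihomotopyEquivalences C).of_precomp _ _ hw hf

/-- Given a square `b` in `B` and lifts to `E` of the bottom and of the two sides, the top lifts to
a path between the end points of the lifted sides. -/
theorem difibrations.exists_top {E B X : Under C} {p : E ⟶ B} (hp : difibrations C p)
    {γ δ₀ δ₁ : X.right → unitInterval → E.right}
    {b : X.right → unitInterval × unitInterval → B.right}
    (hγ : IsDifamily γ) (hδ₀ : IsDifamily δ₀) (hδ₁ : IsDifamily δ₁) (hb : IsDifamily b)
    (h₀ : ∀ x, γ x 0 = δ₀ x 0) (h₁ : ∀ x, γ x 1 = δ₁ x 0)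
    (hpγ : ∀ x t, p.right (γ x t) = b x (t, 0)) (hpδ₀ : ∀ x u, p.right (δ₀ x u) = b x (0, u))
    (hpδ₁ : ∀ x u, p.right (δ₁ x u) = b x (1, u)) :
    ∃ τ : X.right → unitInterval → E.right, IsDifamily τ ∧ (∀ x, τ x 0 = δ₀ x 1) ∧
      (∀ x, τ x 1 = δ₁ x 1) ∧ ∀ x t, p.right (τ x t) = b x (t, 1) := by
  -- `(J₁, J₂)` runs down the left side, along the bottom and up the right side, in one third of the
  -- time each.
  let J₁ : unitInterval → unitInterval := fun t => clamp (3 * t - 1)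
  let J₂ : unitInterval → unitInterval := fun t => clamp (max (1 - 3 * t) (3 * t - 2))
  have hJ₁ : Continuous J₁ := continuous_clamp.comp (by fun_prop)
  have hJ₂ : Continuous J₂ := continuous_clamp.comp (by fun_prop)
  -- From `(J₁ t, J₂ t)` the second coordinate rises at unit speed while the first moves towards `t`
  -- at most as fast. The estimate `key` below says that `(t, 1)` is reached by time `1 - J₂ t`.
  -- This replaces a homeomorphism of the square straightening three sides to one.
  let D : unitInterval × unitInterval → unitInterval × unitInterval := fun q =>
    (clamp (J₁ q.1 + max (-(q.2 : ℝ)) (min q.2 (q.1 - J₁ q.1))), clamp (J₂ q.1 + q.2))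
  have hD : Continuous D := (continuous_clamp.comp (by fun_prop)).prodMk
    (continuous_clamp.comp (by fun_prop))
  have hD0 : ∀ t, D (t, 0) = (J₁ t, J₂ t) := fun t => by
    have : max 0 (min 0 ((t : ℝ) - J₁ t)) = 0 := max_eq_left (min_le_left _ _)
    simp only [D, Set.Icc.coe_zero, neg_zero, this, add_zero, clamp_coe]
  have hD1 : ∀ t, D (t, unitInterval.symm (J₂ t)) = (t, 1) := fun t => by
    have ht0 := t.2.1
    have ht1 := t.2.2
    have key : |(t : ℝ) - J₁ t| ≤ 1 - J₂ t := by
      simp only [J₁, J₂]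
      rcases le_total (3 * (t : ℝ)) 1 with h | h
      · rw [clamp_of_le_zero (by linarith), max_eq_left (by linarith),
          coe_clamp ⟨by linarith, by linarith⟩, abs_le]
        constructor <;> norm_num <;> linarith
      · rcases le_total (3 * (t : ℝ)) 2 with h' | h'
        · rw [coe_clamp ⟨by linarith, by linarith⟩,
            clamp_of_le_zero (max_le (by linarith) (by linarith)), abs_le]
          constructor <;> norm_num <;> linarith
        · rw [clamp_of_one_le (by linarith), max_eq_right (by linarith),
            coe_clamp ⟨by linarith, by linarith⟩, abs_le]
          constructor <;> norm_num <;> linarith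
    rw [abs_le] at key
    simp only [D, unitInterval.coe_symm_eq]
    rw [min_eq_right key.2, max_eq_right key.1, add_sub_cancel, add_sub_cancel, clamp_coe,
      clamp_of_one_le le_rfl]
  let c : ℝ → unitInterval → unitInterval := fun k t => clamp (3 * t - k)
  have hc : ∀ k, Continuous (c k) := fun k => continuous_clamp.comp (by fun_prop)
  have hΓ := IsDifamily.ite_le (a := fun t : unitInterval => 3 * (t : ℝ)) (b := fun _ => 1)
    (hδ₀.reparam (unitInterval.continuous_symm.comp (hc 0)))
    (IsDifamily.ite_le (a := fun t : unitInterval => 3 * (t : ℝ)) (b := fun _ => 2)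
      (hγ.reparam (hc 1)) (hδ₁.reparam (hc 2)) (by fun_prop) (by fun_prop) (fun x t ht => by
        simp only [c, ht]
        rw [clamp_of_one_le (by norm_num), clamp_of_le_zero (by norm_num), h₁]))
    (by fun_prop) (by fun_prop) (fun x t ht => by
        simp only [c, ht, Function.comp_apply]
        rw [clamp_of_one_le (by norm_num), if_pos (by norm_num), clamp_of_le_zero (by norm_num), h₀,
          unitInterval.symm_one])
  obtain ⟨L, hL, hL0, hL1⟩ := hp.exists_lift hΓ (hb.reparam hD) (fun x t => by
    simp only [hD0, J₁, J₂]
    have ht0 := t.2.1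
    have ht1 := t.2.2
    split_ifs with h h'
    · rw [hpδ₀, clamp_of_le_zero (by linarith), max_eq_left (by linarith)]
      congr 2
      ext
      rw [coe_clamp ⟨by linarith, by linarith⟩]
      simp only [c, Function.comp_apply, unitInterval.coe_symm_eq]
      rw [coe_clamp ⟨by linarith, by linarith⟩]
      ring
    · rw [hpγ, clamp_of_le_zero (max_le (by linarith) (by linarith))]
    · rw [hpδ₁, clamp_of_one_le (by linarith), max_eq_right (by linarith)])
  -- For `t = 0` and `t = 1` the reading time `1 - J₂ t` is `0`, so the end points are exactly those
  -- of the lifted sides.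
  refine ⟨fun x t => L x (t, unitInterval.symm (J₂ t)), hL.reparam
    (continuous_id.prodMk (unitInterval.continuous_symm.comp hJ₂)), fun x => ?_, fun x => ?_,
    fun x t => by rw [hL1, hD1]⟩
  · have : J₂ 0 = 1 := clamp_of_one_le (by norm_num)
    simp only [this, unitInterval.symm_one, hL0]
    simp [c]
  · have : J₂ 1 = 1 := clamp_of_one_le (by norm_num)
    simp only [this, unitInterval.symm_one, hL0]
    norm_num [c]

/-! ### Trivial difibrations -/

theorem trivialDifibrations.exists_section {E B : Under C} {p : E ⟶ B}
    (hp : trivialDifibrations C p) : ∃ s : B ⟶ E, s ≫ p = 𝟙 B ∧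
      ∃ K : E.right → unitInterval → E.right, IsDifamily K ∧
        (∀ e, K e 0 = s.right (p.right e)) ∧ (∀ e, K e 1 = e) ∧
        ∀ e t, p.right (K e t) = p.right e := by
  obtain ⟨hf, g, hg, hg'⟩ := hp
  obtain ⟨H, hH, H0, H1⟩ := dihomotopic_iff.1 hg
  -- Lifting the dihomotopy from `p ∘ g` to the identity, starting at `g`, ends at a strict section.
  obtain ⟨L, hL, hL0, hL1⟩ := difibrations_iff.1 hf _ g H hH H0
  have hs : hL.at' 1 ≫ p = 𝟙 B := hom_ext fun x => (hL1 x 1).trans (H1 x)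
  refine ⟨hL.at' 1, hs, ?_⟩
  have hgs : Dihomotopic g (hL.at' 1) := dihomotopic_iff.2 ⟨L, hL, hL0, fun _ => rfl⟩
  generalize hL.at' 1 = s at hs hgs
  have hsp : ∀ x, p.right (s.right x) = x := fun x =>
    hom_congr hs x
  have hK : Dihomotopic (p ≫ s) (𝟙 E) := (hgs.symm.precomp p).trans hg'
  have hl : ∀ t : unitInterval, max 1 t = 1 := fun t => sup_eq_left.2 unitInterval.le_one'
  have hr : ∀ t : unitInterval, max t 1 = 1 := fun t => sup_eq_right.2 unitInterval.le_one'
  obtain ⟨K, hK, K0, K1⟩ := dihomotopic_iff.1 hK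
  -- `K` need not be vertical. In the square `p K (max t u)` the bottom lifts to `K`, the left side
  -- to `s p K` and the right side to a constant. The top is constant at `p e`, so its lift is a
  -- vertical path from `s (p e)` to `e`.
  obtain ⟨V, hV, V0, V1, V2⟩ := hf.exists_top hK ((hK.postcomp (p ≫ s)))
    (IsDifamily.const (T := unitInterval) (𝟙 E))
    ((hK.postcomp p).reparam (S := unitInterval × unitInterval) (r := fun q => q.1 ⊔ q.2)
      (by fun_prop)) (fun x => by simp [K0, hsp]) (fun x => by simp [K1])
    (fun x t => by simp) (fun x t => by simp [hsp]) (fun x t => by simp [hl, K1])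
  refine ⟨V, hV, fun e => ?_, fun e => ?_, fun e t => ?_⟩
  · simp [V0, K1]
  · simp [V1]
  · simp [V2, hr, K1]

/-- A path in the base of a trivial difibration lifts to a path with prescribed end points. -/
theorem trivialDifibrations.exists_path {E B X : Under C} {p : E ⟶ B}
    (hp : trivialDifibrations C p) (e₀ e₁ : X ⟶ E) {β : X.right → unitInterval → B.right}
    (hβ : IsDifamily β) (h₀ : ∀ x, β x 0 = p.right (e₀.right x))
    (h₁ : ∀ x, β x 1 = p.right (e₁.right x)) :
    ∃ F : X.right → unitInterval → E.right, IsDifamily F ∧ (∀ x, F x 0 = e₀.right x) ∧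
      (∀ x, F x 1 = e₁.right x) ∧ ∀ x t, p.right (F x t) = β x t := by
  obtain ⟨s, hs, K, hK, K0, K1, K2⟩ := hp.exists_section
  have hsp : ∀ x, p.right (s.right x) = x := fun x =>
    hom_congr hs x
  -- The lift `s β` has the wrong end points; the vertical paths `K` along the two sides correct
  -- them.
  obtain ⟨F, hF, F0, F1, F2⟩ := hp.1.exists_top (hβ.postcomp s) (hK.comp e₀) (hK.comp e₁)
    (hβ.reparam (S := unitInterval × unitInterval) continuous_fst)
    (fun x => by simp [K0, h₀]) (fun x => by simp [K0, h₁]) (fun x t => by simp [hsp])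
    (fun x t => by simp [K2, h₀]) (fun x t => by simp [K2, h₁])
  exact ⟨F, hF, by simp [F0, K1], by simp [F1, K1], F2⟩

/-! ### Pushouts -/

section Pushout

variable {A B X : Under C} (f : A ⟶ B) (i : A ⟶ X)

/-- The preorder on `B ⊕ X` whose quotient is the pushout: `p ≤ q` if this holds after applying any
pair of `C`-dimaps that agree on `A`. -/
def pushoutLE (p q : B.right ⊕ X.right) : Prop :=
  ∀ (Y : Under C) (g : B ⟶ Y) (h : X ⟶ Y), f ≫ g = i ≫ h →
    Sum.elim (fun b => g.right b) (fun x => h.right x) p ≤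
      Sum.elim (fun b => g.right b) (fun x => h.right x) q

/-- The equivalence relation on `B ⊕ X` that defines the pushout. -/
def pushoutSetoid : Setoid (B.right ⊕ X.right) where
  r p q := pushoutLE f i p q ∧ pushoutLE f i q p
  iseqv :=
    { refl := fun _ => ⟨fun _ _ _ _ => le_rfl, fun _ _ _ _ => le_rfl⟩
      symm := fun h => ⟨h.2, h.1⟩
      trans := fun h k => ⟨fun Y g g' w => (h.1 Y g g' w).trans (k.1 Y g g' w),
        fun Y g g' w => (k.2 Y g g' w).trans (h.2 Y g g' w)⟩ }

/-- The relation induced by `pushoutLE` on the quotient. -/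
def pushoutQuotLE : _root_.Quotient (pushoutSetoid f i) → _root_.Quotient (pushoutSetoid f i) →
    Prop :=
  Quotient.lift₂ (pushoutLE f i) (fun _ _ _ _ h k => propext
    ⟨fun l Y g g' w => ((h.2 Y g g' w).trans (l Y g g' w)).trans (k.1 Y g g' w),
      fun l Y g g' w => ((h.1 Y g g' w).trans (l Y g g' w)).trans (k.2 Y g g' w)⟩)

/-- The underlying pospace of the pushout. -/
def pushoutPospace : PoTop.{u} where
  carrier := _root_.Quotient (pushoutSetoid f i)
  top := inferInstanceAs (TopologicalSpace (_root_.Quotient (pushoutSetoid f i)))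
  ord :=
    { le := pushoutQuotLE f i
      lt := fun p q => pushoutQuotLE f i p q ∧ ¬ pushoutQuotLE f i q p
      lt_iff_le_not_ge := fun _ _ => Iff.rfl
      le_refl := by
        rintro ⟨p⟩
        exact fun _ _ _ _ => le_rfl
      le_trans := by
        rintro ⟨p⟩ ⟨q⟩ ⟨r⟩ h k
        exact fun Y g g' w => (h Y g g' w).trans (k Y g g' w)
      le_antisymm := by
        rintro ⟨p⟩ ⟨q⟩ h k
        exact Quotient.sound ⟨h, k⟩ }

theorem pushout_sound (a : A.right) :
    Quotient.mk (pushoutSetoid f i) (Sum.inl (f.right a)) =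
      Quotient.mk (pushoutSetoid f i) (Sum.inr (i.right a)) := by
  have : ∀ (Y : Under C) (g : B ⟶ Y) (h : X ⟶ Y), f ≫ g = i ≫ h →
      g.right (f.right a) = h.right (i.right a) := fun Y g h w =>
    hom_congr w a
  exact Quotient.sound ⟨fun Y g h w => (this Y g h w).le, fun Y g h w => (this Y g h w).ge⟩

/-- The pushout, as a `C`-pospace. -/
def pushoutObj : Under C :=
  Under.mk (Y := pushoutPospace f i)
    ({ toFun := fun c => Quotient.mk (pushoutSetoid f i) (Sum.inl (str B c))
       monotone' := fun _ _ h _ g _ _ => monotone_hom g.right (monotone_hom (str B) h)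
       continuous_toFun := continuous_quotient_mk'.comp
        (continuous_inl.comp (continuous_hom (str B))) } : C →Co pushoutPospace f i)

/-- The first map to the pushout. -/
def pushoutInl : B ⟶ pushoutObj f i :=
  mkHom (Y := pushoutObj f i) (fun b => Quotient.mk (pushoutSetoid f i) (Sum.inl b))
    (continuous_quotient_mk'.comp continuous_inl) (fun _ _ h _ g _ _ => monotone_hom g.right h)
    (fun _ => rfl)

/-- The second map to the pushout. -/
def pushoutInr : X ⟶ pushoutObj f i :=
  mkHom (Y := pushoutObj f i) (fun x => Quotient.mk (pushoutSetoid f i) (Sum.inr x))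
    (continuous_quotient_mk'.comp continuous_inr) (fun _ _ h _ _ g _ => monotone_hom g.right h)
    (fun c => by
      rw [← right_str i c, ← pushout_sound, right_str]
      rfl)

/-- The map out of the pushout induced by a commutative square. -/
def pushoutDesc {Y : Under C} (g : B ⟶ Y) (h : X ⟶ Y) (w : f ≫ g = i ≫ h) :
    pushoutObj f i ⟶ Y :=
  mkHom (X := pushoutObj f i)
    (_root_.Quotient.lift (Sum.elim (fun b => g.right b) (fun x => h.right x))
      (fun _ _ k => le_antisymm (k.1 Y g h w) (k.2 Y g h w)))
    (((continuous_hom g.right).sumElim (continuous_hom h.right)).quotient_lift _)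
    (by
      rintro ⟨p⟩ ⟨q⟩ k
      exact k Y g h w)
    (fun c => right_str g c)

/-- Since the order quantifies over all cocones, an induced map is well defined and monotone by
instantiation, and the quotient topology makes it continuous. Neither leg has to be a dicofibration.
-/
theorem isPushout_pushoutObj : IsPushout f i (pushoutInl f i) (pushoutInr f i) :=
  .of_isColimit' ⟨hom_ext fun a => pushout_sound f i a⟩
    (PushoutCocone.IsColimit.mk _ (fun s => pushoutDesc f i s.inl s.inr s.condition)
      (fun _ => rfl) (fun _ => rfl) (fun s m h k => hom_ext (by
        rintro ⟨b | x⟩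
        · exact hom_congr h b
        · exact hom_congr k x)))

end Pushout

/-- Maps out of a pushout are dihomotopic if they are so on the two pieces, by dihomotopies that
agree on `A`. -/
theorem dihomotopic_of_isPushout {A B X P Y : Under C} {f : A ⟶ B} {i : A ⟶ X} {i' : B ⟶ P}
    {f' : X ⟶ P} (sq : IsPushout f i i' f') {u v : P ⟶ Y} {F : B.right → unitInterval → Y.right}
    {G : X.right → unitInterval → Y.right} (hF : IsDifamily F) (hG : IsDifamily G)
    (h : ∀ a t, F (f.right a) t = G (i.right a) t) (hF0 : ∀ b, F b 0 = u.right (i'.right b))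
    (hF1 : ∀ b, F b 1 = v.right (i'.right b)) (hG0 : ∀ x, G x 0 = u.right (f'.right x))
    (hG1 : ∀ x, G x 1 = v.right (f'.right x)) : Dihomotopic u v := by
  obtain ⟨K, hK, K1, K2⟩ := exists_isDifamily_of_isPushout sq hF hG h
  have e0 : u = hK.at' 0 := sq.hom_ext (hom_ext fun b => ((K1 b 0).trans (hF0 b)).symm)
    (hom_ext fun x => ((K2 x 0).trans (hG0 x)).symm)
  have e1 : v = hK.at' 1 := sq.hom_ext (hom_ext fun b => ((K1 b 1).trans (hF1 b)).symm)
    (hom_ext fun x => ((K2 x 1).trans (hG1 x)).symm)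
  rw [e0, e1]
  exact hK.dihomotopic

/-- Dihomotopy equivalences under `A` are preserved by cobase change along `A ⟶ B`. -/
theorem dihomotopyEquivalences_of_isPushout {A B N X P Q : Under C} {f : A ⟶ B} {j : A ⟶ N}
    {j' : B ⟶ Q} {fN : N ⟶ Q} (sqN : IsPushout f j j' fN) {i : A ⟶ X} {i' : B ⟶ P} {fX : X ⟶ P}
    (sqX : IsPushout f i i' fX) {m : N ⟶ X} {n : X ⟶ N} (hn : i ≫ n = j)
    {F : N.right → unitInterval → N.right} (hF : IsDifamily F)
    (hF0 : ∀ y, F y 0 = n.right (m.right y)) (hF1 : ∀ y, F y 1 = y)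
    (hFj : ∀ a t, F (j.right a) t = j.right a)
    {G : X.right → unitInterval → X.right} (hG : IsDifamily G)
    (hG0 : ∀ x, G x 0 = m.right (n.right x)) (hG1 : ∀ x, G x 1 = x)
    (hGi : ∀ a t, G (i.right a) t = i.right a)
    {m' : Q ⟶ P} (h₁ : j' ≫ m' = i') (h₂ : fN ≫ m' = m ≫ fX) :
    dihomotopyEquivalences C m' := by
  have w : f ≫ j' = i ≫ n ≫ fN := by rw [← Category.assoc, hn, sqN.w]
  have h₃ := sqX.inl_desc _ _ w
  have h₄ := sqX.inr_desc _ _ w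
  refine ⟨sqX.desc _ _ w, ?_, ?_⟩ <;> generalize sqX.desc _ _ w = n' at h₃ h₄
  -- `G` is stationary on `A`, so it glues with the constant dihomotopy on `B`.
  · refine dihomotopic_of_isPushout sqX (IsDifamily.const i') (hG.postcomp fX) (fun a t => ?_)
      (fun b => ?_) (fun b => rfl) (fun x => ?_) (fun x => ?_)
    · rw [hGi]
      exact hom_congr sqX.w a
    · conv_lhs => rw [← h₁, ← h₃]
      rfl
    · have : fX ≫ n' ≫ m' = n ≫ m ≫ fX := by rw [← Category.assoc, h₄, Category.assoc, h₂]
      rw [hG0]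
      exact hom_congr this.symm x
    · rw [hG1]; rfl
  · refine dihomotopic_of_isPushout sqN (IsDifamily.const j') (hF.postcomp fN) (fun a t => ?_)
      (fun b => ?_) (fun b => rfl) (fun x => ?_) (fun x => ?_)
    · rw [hFj]
      exact hom_congr sqN.w a
    · conv_lhs => rw [← h₃, ← h₁]
      rfl
    · have : fN ≫ m' ≫ n' = m ≫ n ≫ fN := by rw [← Category.assoc, h₂, Category.assoc, h₄]
      rw [hF0]
      exact hom_congr this.symm x
    · rw [hF1]; rfl

/-! ### Strong deformation retracts -/

/-- `i : A ⟶ X` is the inclusion of a strong deformation retract. -/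
def IsDeformationRetract {A X : Under C} (i : A ⟶ X) : Prop :=
  ∃ r : X ⟶ A, i ≫ r = 𝟙 A ∧ ∃ F : X.right → unitInterval → X.right, IsDifamily F ∧
    (∀ x, F x 0 = i.right (r.right x)) ∧ (∀ x, F x 1 = x) ∧
    ∀ a t, F (i.right a) t = i.right a

namespace IsDeformationRetract

theorem dihomotopyEquivalences {A X : Under C} {i : A ⟶ X} (hi : IsDeformationRetract i) :
    dihomotopyEquivalences C i := by
  obtain ⟨r, hr, F, hF, F0, F1, -⟩ := hi
  exact ⟨r, dihomotopic_iff.2 ⟨F, hF, F0, F1⟩, by rw [hr]; exact .refl _⟩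

/-- A strong deformation retraction makes `i` an equivalence under `A` from `A` itself, whose cobase
change is `B`. -/
theorem dihomotopyEquivalences_cobase {A B X P : Under C} {f : A ⟶ B} {i : A ⟶ X} {i' : B ⟶ P}
    {f' : X ⟶ P} (hi : IsDeformationRetract i) (sq : IsPushout f i i' f') :
    PoTop.dihomotopyEquivalences C i' := by
  obtain ⟨r, hr, F, hF, F0, F1, F2⟩ := hi
  exact dihomotopyEquivalences_of_isPushout (IsPushout.of_vert_isIso ⟨by simp⟩) sq
    (m := i) hr (IsDifamily.const (𝟙 A))
    (fun a => (hom_congr hr a).symm)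
    (fun _ => rfl) (fun _ _ => rfl) hF F0 F1 F2 (Category.id_comp i') sq.w

end IsDeformationRetract

/-- Lift the identity of `X` through `ev₁ i`, with constant paths prescribed on `A`. The lift
assigns to `x` a path from a point of `A` to `x`, which is the retraction and the deformation at
once. -/
theorem dicofibrations.isDeformationRetract {A X : Under C} {i : A ⟶ X} (hi : dicofibrations C i)
    (hw : dihomotopyEquivalences C i) : IsDeformationRetract i := by
  obtain ⟨k, hk, hk', hk₁, -⟩ := mapPath.exists_const i
  have sq : CommSq k i (mapPath.ev₁ i) (𝟙 X) := ⟨by simp [hk₁]⟩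
  have := hi _ (trivialDifibrations_ev₁ hw)
  refine ⟨sq.lift ≫ mapPath.fst i, by rw [← Category.assoc, sq.fac_left, hk], _,
    (mapPath.isDifamily_path i).comp sq.lift, fun x => mapPath.path_zero i _, fun x => ?_,
    fun a t => ?_⟩
  · exact hom_congr sq.fac_right x
  · have h : sq.lift.right (i.right a) = k.right a := hom_congr sq.fac_left a
    simp only [h, hk']

/-- The dihomotopy extension property of `C`-dicofibrations. -/
theorem dicofibrations.exists_extension {A X Y : Under C} {i : A ⟶ X} (hi : dicofibrations C i)
    (f : X ⟶ Y) {K : A.right → unitInterval → Y.right} (hK : IsDifamily K)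
    (h : ∀ a, K a 1 = f.right (i.right a)) :
    ∃ F : X.right → unitInterval → Y.right, IsDifamily F ∧ (∀ x, F x 1 = f.right x) ∧
      ∀ a t, F (i.right a) t = K a t := by
  -- The mapping path space of `𝟙 Y` serves as the path space of `Y`, whose evaluation at `1` is a
  -- trivial difibration.
  obtain ⟨k, -, hk⟩ := mapPath.exists_hom (𝟙 Y) (a := hK.at' 0) hK (fun _ => rfl)
  have sq : CommSq k i (mapPath.ev₁ (𝟙 Y)) f := ⟨hom_ext fun a => (hk a 1).trans (h a)⟩
  have := hi _ (trivialDifibrations_ev₁ (dihomotopyEquivalences_of_isIso (𝟙 Y)))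
  refine ⟨_, (mapPath.isDifamily_path _).comp sq.lift, fun x => ?_, fun a t => ?_⟩
  · exact hom_congr sq.fac_right x
  · rw [← hk a t]
    exact congrArg (fun q => mapPath.path _ q t)
      (hom_congr sq.fac_left a)

/-! ### Cylinders and mapping cylinders -/

/-- The `C`-dimap `i₁ : X ⟶ X □ I`, `x ↦ [x, 1]`. -/
def cylι₁ (X : Under C) : X ⟶ cylinder X := (isDifamily_cylPt X).at' 1

/-- The projection `X □ I ⟶ X`. -/
def cylProj (X : Under C) : cylinder X ⟶ X := cylDesc (IsDifamily.const (𝟙 X))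

@[simp]
theorem cylι₀_proj (X : Under C) : cylι₀ X ≫ cylProj X = 𝟙 X := rfl

@[simp]
theorem cylι₁_proj (X : Under C) : cylι₁ X ≫ cylProj X = 𝟙 X := rfl

theorem exists_cylinder_family {X Y : Under C} {G : X.right → unitInterval × unitInterval → Y.right}
    (hG : IsDifamily G) : ∃ K : (cylinder X).right → unitInterval → Y.right, IsDifamily K ∧
      ∀ x t s, K (cylPt x t) s = G x (t, s) := by
  obtain ⟨F, hF, -, h⟩ := mapPath.exists_family (𝟙 Y)
    (hG.reparam (r := fun t : unitInterval => (t, 0)) (by fun_prop)) hG (fun _ _ => rfl)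
  exact ⟨_, (mapPath.isDifamily_path _).comp (cylDesc hF), h⟩

theorem isDeformationRetract_cylι₀ (X : Under C) : IsDeformationRetract (cylι₀ X) := by
  obtain ⟨K, hK, h⟩ := exists_cylinder_family ((isDifamily_cylPt X).reparam
    (S := unitInterval × unitInterval) (r := fun q => q.1 * q.2) (by fun_prop))
  refine ⟨cylProj X, rfl, K, hK, ?_, ?_, fun x t => ?_⟩
  · rintro ⟨x, t⟩
    exact (h x t 0).trans (by rw [mul_zero]; rfl)
  · rintro ⟨x, t⟩
    exact (h x t 1).trans (by rw [mul_one]; rfl)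
  · exact (h x 0 t).trans (by rw [zero_mul]; rfl)

theorem dihomotopyEquivalences_cylProj (X : Under C) : dihomotopyEquivalences C (cylProj X) :=
  (dihomotopyEquivalences C).of_precomp _ _ (isDeformationRetract_cylι₀ X).dihomotopyEquivalences
    (dihomotopyEquivalences_of_isIso (𝟙 X))

/-- The inclusion of the two ends of the cylinder is a `C`-dicofibration. -/
theorem dicofibrations_ends {X Z Q : Under C} {i : Z ⟶ X} {k₀ k₁ : X ⟶ Q}
    (sq : IsPushout i i k₀ k₁) {j : Q ⟶ cylinder X} (h₀ : k₀ ≫ j = cylι₀ X)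
    (h₁ : k₁ ≫ j = cylι₁ X) : dicofibrations C j := by
  refine fun E B p hp => ⟨fun {e b} w => ⟨?_⟩⟩
  have w₀ : (k₀ ≫ e) ≫ p = cylι₀ X ≫ b := by rw [Category.assoc, w.w, ← Category.assoc, h₀]
  have w₁ : (k₁ ≫ e) ≫ p = cylι₁ X ≫ b := by rw [Category.assoc, w.w, ← Category.assoc, h₁]
  obtain ⟨F, hF, F0, F1, F2⟩ := trivialDifibrations.exists_path hp (k₀ ≫ e) (k₁ ≫ e)
    ((isDifamily_cylPt X).postcomp b)
    (fun x => (hom_congr w₀ x).symm)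
    (fun x => (hom_congr w₁ x).symm)
  refine ⟨⟨cylDesc hF, sq.hom_ext ?_ ?_, cylinder_hom_ext F2⟩⟩
  · rw [← Category.assoc, h₀]
    exact hom_ext F0
  · rw [← Category.assoc, h₁]
    exact hom_ext F1

section MappingCylinder

variable {A B M : Under C} {f : A ⟶ B} {b : B ⟶ M} {c : cylinder A ⟶ M}

/-- The inclusion of the free end of a mapping cylinder is a `C`-dicofibration. -/
theorem dicofibrations_mappingCylinder (sq : IsPushout f (cylι₀ A) b c) :
    dicofibrations C (cylι₁ A ≫ c) := by
  refine fun E D p hp => ⟨fun {e d} w => ⟨?_⟩⟩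
  obtain ⟨s, hs, -⟩ := trivialDifibrations.exists_section hp
  have hs' : ∀ x, p.right (s.right x) = x := fun x =>
    hom_congr hs x
  -- Nothing is prescribed on `B`, so the section provides the lift there; on the cylinder a path
  -- joins it to `e` at the free end.
  obtain ⟨F, hF, F0, F1, F2⟩ := trivialDifibrations.exists_path hp (f ≫ b ≫ d ≫ s) e
    ((isDifamily_cylPt A).postcomp (c ≫ d))
    (fun x => by
      simp only [right_comp_apply, hs']
      exact congrArg (fun y => d.right y)
        (hom_congr sq.w x).symm)
    (fun x => (hom_congr w.w x).symm)
  have hw : f ≫ b ≫ d ≫ s = cylι₀ A ≫ cylDesc hF := hom_ext fun x => (F0 x).symm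
  refine ⟨⟨sq.desc (b ≫ d ≫ s) (cylDesc hF) hw, ?_, sq.hom_ext ?_ ?_⟩⟩
  · rw [Category.assoc, sq.inr_desc]
    exact hom_ext F1
  · rw [← Category.assoc, sq.inl_desc, Category.assoc, Category.assoc, hs, Category.comp_id]
  · rw [← Category.assoc, sq.inr_desc]
    exact cylinder_hom_ext F2

theorem exists_mappingCylinder_proj (sq : IsPushout f (cylι₀ A) b c) :
    ∃ q : M ⟶ B, dihomotopyEquivalences C q ∧ (cylι₁ A ≫ c) ≫ q = f := by
  have w : f ≫ 𝟙 B = cylι₀ A ≫ cylProj A ≫ f := by simp [← Category.assoc]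
  refine ⟨sq.desc _ _ w, ?_, ?_⟩
  · refine (dihomotopyEquivalences C).of_precomp _ _
      ((isDeformationRetract_cylι₀ A).dihomotopyEquivalences_cobase sq) ?_
    rw [sq.inl_desc]
    exact dihomotopyEquivalences_of_isIso _
  · rw [Category.assoc, sq.inr_desc, ← Category.assoc, cylι₁_proj, Category.id_comp]

end MappingCylinder

/-- The cobase extension of a dihomotopy equivalence along a `C`-dicofibration is a dihomotopy
equivalence. -/
theorem dihomotopyEquivalences_cobase {A B X P : Under C} {f : A ⟶ B} {i : A ⟶ X} {i' : B ⟶ P}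
    {f' : X ⟶ P} (sq : IsPushout f i i' f') (hi : dicofibrations C i)
    (hf : dihomotopyEquivalences C f) : dihomotopyEquivalences C f' := by
  -- `M` is the mapping cylinder of `f`, `N` is `X` with a cylinder on `A` attached at time `1`, and
  -- `L` is their union along the cylinder. The map `f'` factors as `X ⟶ L ⟶ P`, and both factors
  -- are shown to be equivalences.
  have sqM := isPushout_pushoutObj f (cylι₀ A)
  have sqN := isPushout_pushoutObj i (cylι₁ A)
  generalize pushoutObj f (cylι₀ A) = M, pushoutInl f (cylι₀ A) = b,
    pushoutInr f (cylι₀ A) = c at sqM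
  generalize pushoutObj i (cylι₁ A) = N, pushoutInl i (cylι₁ A) = nX,
    pushoutInr i (cylι₁ A) = nc at sqN
  have sqL := isPushout_pushoutObj nc c
  generalize pushoutObj nc c = L, pushoutInl nc c = lN, pushoutInr nc c = lM at sqL
  have hj : dihomotopyEquivalences C (cylι₁ A ≫ c) := by
    obtain ⟨q, hq, hq'⟩ := exists_mappingCylinder_proj sqM
    rw [← hq'] at hf
    exact (dihomotopyEquivalences C).of_postcomp _ _ hq hf
  have hXL : dihomotopyEquivalences C (nX ≫ lN) :=
    ((dicofibrations_mappingCylinder sqM).isDeformationRetract hj).dihomotopyEquivalences_cobase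
      (sqN.paste_vert sqL)
  have wm : i ≫ 𝟙 X = cylι₁ A ≫ cylProj A ≫ i := by simp [← Category.assoc]
  obtain ⟨m, hmX, hmc⟩ : ∃ m : N ⟶ X, nX ≫ m = 𝟙 X ∧ nc ≫ m = cylProj A ≫ i :=
    ⟨sqN.desc _ _ wm, sqN.inl_desc _ _ _, sqN.inr_desc _ _ _⟩
  have hmX' : ∀ x, m.right (nX.right x) = x := fun x =>
    hom_congr hmX x
  have hmc' : ∀ a t, m.right (nc.right (cylPt a t)) = i.right a := fun a t =>
    hom_congr hmc (cylPt a t)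
  -- The collapse `m : N ⟶ X` has an inverse under `A`, up to dihomotopy under `A`: drag `A` along
  -- the cylinder to its free end and extend to `X`. Time `0` of `R` is that inverse.
  obtain ⟨R, hR, R1, R2⟩ := hi.exists_extension nX ((isDifamily_cylPt A).postcomp nc)
    (fun a => (hom_congr sqN.w a).symm)
  obtain ⟨S, hS, S1⟩ := exists_cylinder_family (((isDifamily_cylPt A).postcomp nc).reparam
    (S := unitInterval × unitInterval) (r := fun q => q.1 * q.2) (by fun_prop))
  obtain ⟨F, hF, F1, F2⟩ := exists_isDifamily_of_isPushout sqN hR hS (fun a t => by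
    rw [R2]
    exact ((S1 a 1 t).trans (by rw [one_mul])).symm)
  -- `L` is also the cobase change of `N` along `f`, via the free end of the cylinder.
  have sqL' := sqM.paste_vert sqL.flip
  have hF' : ∀ a t s, F (nc.right (cylPt a t)) s = nc.right (cylMk A (a, t * s)) :=
    fun a t s => (F2 _ s).trans (S1 a t s)
  have hn : i ≫ hR.at' 0 = cylι₀ A ≫ nc := hom_ext fun a => R2 a 0
  have hF0 : m ≫ hR.at' 0 = hF.at' 0 := by
    refine sqN.hom_ext ?_ ?_
    · rw [← Category.assoc, hmX, Category.id_comp]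
      exact hom_ext fun x => (F1 x 0).symm
    · rw [← Category.assoc, hmc, Category.assoc, hn]
      refine cylinder_hom_ext fun a t => ?_
      exact ((hF' a t 0).trans (by rw [mul_zero]; rfl)).symm
  have hF1 : hF.at' 1 = 𝟙 N := by
    refine sqN.hom_ext (hom_ext fun x => (F1 x 1).trans (R1 x)) (cylinder_hom_ext fun a t => ?_)
    exact (hF' a t 1).trans (by rw [mul_one]; rfl)
  have wL : f ≫ i' = (cylι₀ A ≫ nc) ≫ m ≫ f' := by
    rw [sq.w, Category.assoc, ← Category.assoc nc, hmc, ← Category.assoc, ← Category.assoc,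
      cylι₀_proj, Category.id_comp]
  have hm' := dihomotopyEquivalences_of_isPushout sqL' sq (m := m) (n := hR.at' 0) hn hF
    (fun y => (hom_congr hF0 y).symm)
    (fun y => hom_congr hF1 y)
    (fun a t => (hF' a 0 t).trans (by rw [zero_mul]; rfl)) (hR.postcomp m) (fun _ => rfl)
    (fun x => by rw [R1, hmX']) (fun a t => by rw [R2, hmc'])
    (sqL'.inl_desc _ _ wL) (sqL'.inr_desc _ _ wL)
  have hf' : f' = (nX ≫ lN) ≫ sqL'.desc _ _ wL := by
    rw [Category.assoc, sqL'.inr_desc, ← Category.assoc, hmX, Category.id_comp]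
  rw [hf']
  exact (dihomotopyEquivalences C).comp_mem _ _ hXL hm'

/-! ### The axioms and the homotopy relation -/

theorem isFibrant (X : Under C) :
    Baues.IsFibrant (dicofibrations C) (dihomotopyEquivalences C) X := by
  intro E i hi hw
  obtain ⟨r, hr, -⟩ := hi.isDeformationRetract hw
  exact ⟨r, hr⟩

theorem isCofibrant (X : Under C) :
    Baues.IsCofibrant (dicofibrations C) (Under.mkIdInitial (X := C)) X := by
  refine fun E B p hp => ⟨fun {e b} w => ⟨?_⟩⟩
  obtain ⟨s, hs, -⟩ := trivialDifibrations.exists_section hp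
  exact ⟨⟨b ≫ s, Under.mkIdInitial.hom_ext _ _, by rw [Category.assoc, hs, Category.comp_id]⟩⟩

theorem isCofibrationCategory (C : PoTop.{u}) :
    Baues.IsCofibrationCategory (dicofibrations C) (dihomotopyEquivalences C) where
  hasInitial := Under.mkIdInitial.hasInitial
  cof_of_iso _ _ f _ := MorphismProperty.llp_of_isIso _ f
  weq_of_iso _ _ f _ := dihomotopyEquivalences_of_isIso f
  cof_comp _ _ _ _ _ hf hg := (trivialDifibrations C).llp.comp_mem _ _ hf hg
  weq_two_of_three := inferInstance
  hasPushout _ _ _ f i _ := (isPushout_pushoutObj f i).hasPushout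
  cof_cobase _ _ _ _ _ _ _ _ sq hi :=
    MorphismProperty.of_isPushout (P := (trivialDifibrations C).llp) sq hi
  trivialCof_cobase _ _ _ _ _ _ _ _ sq hi hw :=
    ⟨MorphismProperty.of_isPushout (P := (trivialDifibrations C).llp) sq hi,
      (hi.isDeformationRetract hw).dihomotopyEquivalences_cobase sq⟩
  weq_cobase _ _ _ _ _ _ _ _ sq hi hf := dihomotopyEquivalences_cobase sq hi hf
  factorization X _ f := by
    have sq := isPushout_pushoutObj f (cylι₀ X)
    obtain ⟨q, hq, hq'⟩ := exists_mappingCylinder_proj sq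
    exact ⟨_, _, q, dicofibrations_mappingCylinder sq, hq, hq'⟩
  fibrant_model X := ⟨X, 𝟙 X, MorphismProperty.llp_of_isIso _ _,
    dihomotopyEquivalences_of_isIso _, isFibrant X⟩

theorem homotopic_iff {X Y : Under C} (f g : X ⟶ Y) :
    Baues.Homotopic (dicofibrations C) (dihomotopyEquivalences C)
      (Under.mkIdInitial (X := C)) f g ↔ Dihomotopic f g := by
  constructor
  · rintro ⟨Q, k₀, k₁, -, Z, j, p, -, ⟨r, -, hr⟩, h₀, h₁, h, rfl, rfl⟩
    -- Both ends of any cylinder object are sections of the equivalence `p`, hence dihomotopic to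
    -- its inverse `r` and to each other.
    have key : ∀ k : X ⟶ Q, k ≫ j ≫ p = 𝟙 X → Dihomotopic (k ≫ j) r := fun k hk => by
      have := (hr.symm.precomp (k ≫ j))
      have e : (k ≫ j) ≫ p ≫ r = r := by
        rw [Category.assoc, ← Category.assoc j, ← Category.assoc k, hk, Category.id_comp]
      rwa [e, Category.comp_id] at this
    have := ((key k₀ h₀).trans (key k₁ h₁).symm).postcomp h
    simpa using this
  · intro H
    obtain ⟨F, hF, F0, F1⟩ := dihomotopic_iff.1 H
    have sq := isPushout_pushoutObj ((Under.mkIdInitial (X := C)).to X)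
      ((Under.mkIdInitial (X := C)).to X)
    have w : (Under.mkIdInitial (X := C)).to X ≫ cylι₀ X =
      (Under.mkIdInitial (X := C)).to X ≫ cylι₁ X := Under.mkIdInitial.hom_ext _ _
    have h₀ := sq.inl_desc _ _ w
    have h₁ := sq.inr_desc _ _ w
    refine ⟨_, _, _, sq, cylinder X, sq.desc _ _ w, cylProj X, dicofibrations_ends sq h₀ h₁,
      dihomotopyEquivalences_cylProj X, ?_, ?_, cylDesc hF, ?_, ?_⟩
    · rw [← Category.assoc, h₀, cylι₀_proj]
    · rw [← Category.assoc, h₁, cylι₁_proj]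
    · rw [← Category.assoc, h₀]
      exact hom_ext F0
    · rw [← Category.assoc, h₁]
      exact hom_ext F1

end PoTop

theorem theorem7p2 (C : PoTop.{u}) :
    Baues.IsCofibrationCategory (PoTop.dicofibrations C) (PoTop.dihomotopyEquivalences C) ∧
    (∀ X : Under C,
      Baues.IsFibrant (PoTop.dicofibrations C) (PoTop.dihomotopyEquivalences C) X) ∧
    (∀ X : Under C,
      Baues.IsCofibrant (PoTop.dicofibrations C) (Under.mkIdInitial (X := C)) X) ∧
    (∀ (X Y : Under C) (f g : X ⟶ Y),
      Baues.Homotopic (PoTop.dicofibrations C) (PoTop.dihomotopyEquivalences C)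
        (Under.mkIdInitial (X := C)) f g ↔ PoTop.Dihomotopic f g) :=
  ⟨PoTop.isCofibrationCategory C, PoTop.isFibrant, PoTop.isCofibrant,
    fun _ _ => PoTop.homotopic_iff⟩
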